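/- Let $F=\mathbb{F}_q$ be a finite field of characteristic $p$ with $q$ elements, and let $\varphi:F\to\mathbb{C}^*$ be the additive character $\varphi(x)=e^{2\pi i\,\mathrm{Tr}_{F/\mathbb{F}_p}(x)/p}$. For an integer $n\ge 1$ and an $n\times n$ matrix $a$ over $F$ let $$K_n(a)=\sum_{x\in \mathrm{GL}_n(F)}\varphi\bigl(\mathrm{tr}(ax+x^{-1})\bigr),$$ and for $\alpha\in F$ let $$K_1(\alpha)=\sum_{x\in F^*}\varphi(\alpha x+x^{-1})$$ be the classical Kloosterman sum. Let $I$ be the $n\times n$ identity matrix. Then for every $\alpha\in F$ with $\alpha\neq 0$, $$K_n(\alpha I)=\sum_{\substack{w\in S_n\\ w^2=1}} q^{\,n(n-1)/2+N(w)}\,(q-1)^{e(w)}\,K_1(\alpha)^{f(w)},$$ where $S_n$ is the group of permutations of $\{1,\dots,n\}$ (the identity is included in the sum), $e(w)$ is the number of 2-cycles of $w$, $f(w)$ is the number of fixed points of $w$, and $$N(w)=\#\{(i,j) : 1\le i<j\le n,\ w(j)<w(i)\le j\}.$$ -/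

import Mathlib

open scoped BigOperators

noncomputable section

namespace MatrixKloosterman

/-- The additive character `φ = φ₀ ∘ Tr_{F/𝔽_p}` of a finite field `F` of characteristic `p`, where
`φ₀ : ZMod p → ℂ` is the additive character with `φ₀ 1 = exp (2πi/p)`. -/
def phi (p : ℕ) [Fact p.Prime] (F : Type*) [Field F] [Algebra (ZMod p) F] (x : F) : ℂ :=
  ZMod.stdAddChar (N := p) (Algebra.trace (ZMod p) F x)

/-- The additive character `ψ = φ ∘ tr` of the matrix algebra `M_n(F)`. -/
def psi (p : ℕ) [Fact p.Prime] {F : Type*} [Field F] [Algebra (ZMod p) F] {n : ℕ}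
    (x : Matrix (Fin n) (Fin n) F) : ℂ :=
  phi p F x.trace

/-- The matrix Kloosterman sum `K_n(a) = ∑_{x ∈ GL_n(F)} ψ(a x + x⁻¹)`. -/
def matrixKloosterman (p : ℕ) [Fact p.Prime] {F : Type*} [Field F] [Fintype F] [DecidableEq F]
    [Algebra (ZMod p) F] {n : ℕ} (a : Matrix (Fin n) (Fin n) F) : ℂ :=
  ∑ x : GL (Fin n) F,
    psi p (a * (x : Matrix (Fin n) (Fin n) F) + ((x⁻¹ : GL (Fin n) F) : Matrix (Fin n) (Fin n) F))

/-- The classical Kloosterman sum `K_1(α) = ∑_{x ∈ Fˣ} φ(α x + x⁻¹)`. -/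
def kloosterman (p : ℕ) [Fact p.Prime] {F : Type*} [Field F] [Fintype F] [DecidableEq F]
    [Algebra (ZMod p) F] (α : F) : ℂ :=
  ∑ x : Fˣ, phi p F (α * (x : F) + ((x⁻¹ : Fˣ) : F))

/-- The number of fixed points of a permutation. -/
def numFixed {n : ℕ} (w : Equiv.Perm (Fin n)) : ℕ :=
  (Finset.univ.filter fun i : Fin n => w i = i).card

/-- The number of 2-cycles of a permutation: the number of pairs `i < j` exchanged by `w`. -/
def numTwoCycles {n : ℕ} (w : Equiv.Perm (Fin n)) : ℕ :=
  (Finset.univ.filter fun ij : Fin n × Fin n =>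
    ij.1 < ij.2 ∧ w ij.1 = ij.2 ∧ w ij.2 = ij.1).card

/-- `N(w) = #{(i, j) : i < j, w(j) < w(i) ≤ j}`. -/
def bigN {n : ℕ} (w : Equiv.Perm (Fin n)) : ℕ :=
  (Finset.univ.filter fun ij : Fin n × Fin n =>
    ij.1 < ij.2 ∧ w ij.2 < w ij.1 ∧ w ij.1 ≤ ij.2).card

end MatrixKloosterman

end

/-! Both sides satisfy the same two-step recursion with the same initial values;
`scalarKloosterman_eq_involutionSum` compares them. Write `S_n` for the sum over involutions without
the factor `q^(n(n-1)/2)`.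

Matrix side (`scalarKloosterman_succ_succ`): fix a basis vector `e` and average over right
translation by transvections `1 + e vᵀ`. By orthogonality of characters only those `x` survive for
which `x⁻¹e - αxe` is a multiple of `e`. If `xe` is a multiple of `e`, then `x` is block triangular
with blocks of sizes `1` and `n+1`, giving `q^(n+1) K_1 K_(n+1)`. Otherwise `y = xe` takes `q^(n+2)
- q` values, all equivalent under conjugation fixing `e`. The plane spanned by `e` and `y` is then
`x`-invariant, and `x` acts on it with determinant `-α⁻¹`, so this block contributes `φ(0) = 1`.
Each `y` thus gives `q^(2n+1) K_n`.

Involution side (`involutionSum_succ_succ`): deleting the cycle through the greatest element gives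
`S_(n+2) = K_1 S_(n+1) + q(q^(n+1) - 1) S_n`. The powers of `q` match because `n(n-1)/2` grows by
`n` at each step. -/

namespace MatrixKloosterman

/-! ### Weighted sums over involutions -/

section Involutions

variable {ι κ : Type*} [Fintype ι] [LinearOrder ι] [Fintype κ] [LinearOrder κ]

/-- The fixed points of a permutation. -/
def fixedSet (w : Equiv.Perm ι) : Finset ι := Finset.univ.filter fun i => w i = i

/-- The increasing pairs exchanged by a permutation. -/
def twoCycleSet (w : Equiv.Perm ι) : Finset (ι × ι) :=
  Finset.univ.filter fun ij => ij.1 < ij.2 ∧ w ij.1 = ij.2 ∧ w ij.2 = ij.1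

/-- The pairs `i < j` with `w j < w i ≤ j`. -/
def bigNSet (w : Equiv.Perm ι) : Finset (ι × ι) :=
  Finset.univ.filter fun ij => ij.1 < ij.2 ∧ w ij.2 < w ij.1 ∧ w ij.1 ≤ ij.2

@[simp]
lemma mem_fixedSet (w : Equiv.Perm ι) (i : ι) : i ∈ fixedSet w ↔ w i = i := by
  simp [fixedSet]

@[simp]
lemma mem_twoCycleSet (w : Equiv.Perm ι) (ij : ι × ι) :
    ij ∈ twoCycleSet w ↔ ij.1 < ij.2 ∧ w ij.1 = ij.2 ∧ w ij.2 = ij.1 := by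
  simp [twoCycleSet]

@[simp]
lemma mem_bigNSet (w : Equiv.Perm ι) (ij : ι × ι) :
    ij ∈ bigNSet w ↔ ij.1 < ij.2 ∧ w ij.2 < w ij.1 ∧ w ij.1 ≤ ij.2 := by
  simp [bigNSet]

/-- The weight `q^{N(w)} (q-1)^{e(w)} K^{f(w)}` of a permutation. -/
def involutionWeight (q K : ℂ) (w : Equiv.Perm ι) : ℂ :=
  q ^ (bigNSet w).card * (q - 1) ^ (twoCycleSet w).card * K ^ (fixedSet w).card

/-- The sum of the weights of the involutions of a finite linear order. -/
def involutionSum (q K : ℂ) (ι : Type*) [Fintype ι] [LinearOrder ι] : ℂ :=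
  ∑ w : Equiv.Perm ι with w ^ 2 = 1, involutionWeight q K w

lemma perm_sq_eq_one_iff {β : Type*} (w : Equiv.Perm β) : w ^ 2 = 1 ↔ ∀ i, w (w i) = i := by
  simp [Equiv.ext_iff, sq]

lemma involutionWeight_permCongr (q K : ℂ) (e : ι ≃o κ) (w : Equiv.Perm ι) :
    involutionWeight q K (e.toEquiv.permCongr w) = involutionWeight q K w := by
  have h1 : (bigNSet w).card = (bigNSet (e.toEquiv.permCongr w)).card :=
    Finset.card_equiv (e.toEquiv.prodCongr e.toEquiv) fun ij => by
      simp [Equiv.permCongr_apply]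
  have h2 : (twoCycleSet w).card = (twoCycleSet (e.toEquiv.permCongr w)).card :=
    Finset.card_equiv (e.toEquiv.prodCongr e.toEquiv) fun ij => by
      simp [Equiv.permCongr_apply]
  have h3 : (fixedSet w).card = (fixedSet (e.toEquiv.permCongr w)).card :=
    Finset.card_equiv e.toEquiv fun i => by
      simp [Equiv.permCongr_apply]
  rw [involutionWeight, involutionWeight, h1, h2, h3]

lemma involutionSum_congr (q K : ℂ) (e : ι ≃o κ) :
    involutionSum q K ι = involutionSum q K κ := by
  refine Finset.sum_equiv e.toEquiv.permCongr (fun w => ?_)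
    fun w _ => (involutionWeight_permCongr q K e w).symm
  simp only [Finset.mem_filter, Finset.mem_univ, true_and, perm_sq_eq_one_iff,
    Equiv.permCongr_apply]
  constructor
  · intro h i
    simp [h]
  · intro h i
    simpa using h (e i)

lemma ofSubtype_sq_eq_one_iff {β : Type*} {p : β → Prop} [DecidablePred p]
    (w : Equiv.Perm (Subtype p)) : Equiv.Perm.ofSubtype w ^ 2 = 1 ↔ w ^ 2 = 1 := by
  rw [← map_pow, ← (Equiv.Perm.ofSubtype (p := p)).map_one,
    (Equiv.Perm.ofSubtype_injective).eq_iff]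

lemma card_eq_card_add_card_filter_range {γ β : Type*} (f : γ ↪ β) (S : Finset β) (S' : Finset γ)
    [DecidablePred fun b => b ∈ Set.range f] (h : ∀ c, c ∈ S' ↔ f c ∈ S) :
    S.card = S'.card + (S.filter fun b => b ∉ Set.range f).card := by
  have : S'.map f = S.filter fun b => b ∈ Set.range f := by
    ext b
    simp only [Finset.mem_map, h, Finset.mem_filter, Set.mem_range]
    constructor
    · rintro ⟨c, hc, rfl⟩
      exact ⟨hc, c, rfl⟩
    · rintro ⟨hb, c, rfl⟩
      exact ⟨c, hb, rfl⟩
  rw [← Finset.card_map f, this, Finset.card_filter_add_card_filter_not]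

/-- A pair of elements satisfying `p`, as a pair in the ambient type. -/
def pairEmbedding {β : Type*} (p : β → Prop) : Subtype p × Subtype p ↪ β × β :=
  (Function.Embedding.subtype p).prodMap (Function.Embedding.subtype p)

lemma mem_range_pairEmbedding {β : Type*} {p : β → Prop} (ij : β × β) :
    ij ∈ Set.range (pairEmbedding p) ↔ p ij.1 ∧ p ij.2 := by
  constructor
  · rintro ⟨c, rfl⟩
    exact ⟨c.1.2, c.2.2⟩
  · rintro ⟨hi, hj⟩
    exact ⟨(⟨ij.1, hi⟩, ⟨ij.2, hj⟩), rfl⟩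

section Restrict

variable {p : ι → Prop} [DecidablePred p] (w : Equiv.Perm ι) (w' : Equiv.Perm (Subtype p))
  (h : ∀ i : Subtype p, w i = w' i)
include h

lemma card_bigNSet_restrict : (bigNSet w).card =
    (bigNSet w').card + ((bigNSet w).filter fun ij => ¬(p ij.1 ∧ p ij.2)).card := by
  classical
  rw [card_eq_card_add_card_filter_range (pairEmbedding p) (bigNSet w) (bigNSet w') fun c => by
    simp [pairEmbedding, h]]
  simp only [mem_range_pairEmbedding]

lemma card_twoCycleSet_restrict : (twoCycleSet w).card =
    (twoCycleSet w').card + ((twoCycleSet w).filter fun ij => ¬(p ij.1 ∧ p ij.2)).card := by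
  classical
  rw [card_eq_card_add_card_filter_range (pairEmbedding p) (twoCycleSet w) (twoCycleSet w')
    fun c => by simp [pairEmbedding, h, Subtype.ext_iff]]
  simp only [mem_range_pairEmbedding]

lemma card_fixedSet_restrict : (fixedSet w).card =
    (fixedSet w').card + ((fixedSet w).filter fun i => ¬p i).card := by
  classical
  rw [card_eq_card_add_card_filter_range (Function.Embedding.subtype p) (fixedSet w) (fixedSet w')
    fun c => by simp [h, Subtype.ext_iff]]
  simp

end Restrict

section Top

variable {M : ι} (hM : ∀ i, i ≤ M)
include hM

/-- No pair counted by `bigNSet` involves `M`: for `j = M` one would need `M < w i`, and `i = M`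
leaves no larger `j`. Only the fixed point `M` is lost. -/
lemma involutionWeight_of_fixes_top (q K : ℂ) (w : Equiv.Perm ι) (w' : Equiv.Perm {i // i ≠ M})
    (h : ∀ i : {i // i ≠ M}, w i = w' i) (hw : w M = M) :
    involutionWeight q K w = K * involutionWeight q K w' := by
  have h1 : ((bigNSet w).filter fun ij => ¬(ij.1 ≠ M ∧ ij.2 ≠ M)) = ∅ := by
    ext ⟨i, j⟩
    simp only [Finset.mem_filter, mem_bigNSet, Finset.notMem_empty, iff_false]
    rintro ⟨⟨h1, h2, h3⟩, h4⟩
    have := hM j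
    have := hM (w i)
    grind
  have h2 : ((twoCycleSet w).filter fun ij => ¬(ij.1 ≠ M ∧ ij.2 ≠ M)) = ∅ := by
    ext ⟨i, j⟩
    simp only [Finset.mem_filter, mem_twoCycleSet, Finset.notMem_empty, iff_false]
    grind
  have h3 : ((fixedSet w).filter fun i => ¬(i ≠ M)) = {M} := by
    ext i
    simp only [Finset.mem_filter, mem_fixedSet, Finset.mem_singleton]
    grind
  rw [involutionWeight, involutionWeight, card_bigNSet_restrict w w' h,
    card_twoCycleSet_restrict w w' h, card_fixedSet_restrict w w' h, h1, h2, h3]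
  simp only [Finset.card_empty, Finset.card_singleton]
  ring

/-- A pair of `bigNSet w` meeting `{b, M}` must have `j = M`: `i = b` forces `M = w b ≤ j`, and `j =
b` would need `M < w i`. The remaining condition is `b < w i`, so such pairs correspond to values
above `b`. -/
lemma involutionWeight_of_swaps_top (q K : ℂ) (w : Equiv.Perm ι) {b : ι} (hb : b ≠ M)
    (w' : Equiv.Perm {i // i ≠ M ∧ i ≠ b})
    (h : ∀ i : {i // i ≠ M ∧ i ≠ b}, w i = w' i) (hw : w M = b) (hw' : w b = M) :
    involutionWeight q K w =
      q ^ (Finset.univ.filter fun i => b < i).card * (q - 1) * involutionWeight q K w' := by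
  have h1 : ((bigNSet w).filter fun ij => ¬((ij.1 ≠ M ∧ ij.1 ≠ b) ∧ (ij.2 ≠ M ∧ ij.2 ≠ b))).card =
      (Finset.univ.filter fun i => b < i).card := by
    symm
    refine Finset.card_bij (fun i _ => (w.symm i, M)) ?_ ?_ ?_
    · intro i hi
      have hi' : b < i := by simpa using hi
      have : w.symm i ≠ M := by
        intro h
        rw [Equiv.symm_apply_eq, hw] at h
        exact hi'.ne' h
      simp [hw, hi', hM i, lt_of_le_of_ne (hM _) this]
    · intro i _ j _ hij
      simpa using hij
    · rintro ⟨i, j⟩ hij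
      simp only [Finset.mem_filter, mem_bigNSet] at hij
      obtain ⟨⟨h1, h2, h3⟩, h4⟩ := hij
      have := hM j
      have := hM (w i)
      have hj : j = M := by grind
      subst hj
      exact ⟨w i, by simpa [hw] using h2, by simp⟩
  have h2 : ((twoCycleSet w).filter fun ij =>
      ¬((ij.1 ≠ M ∧ ij.1 ≠ b) ∧ (ij.2 ≠ M ∧ ij.2 ≠ b))) = {(b, M)} := by
    ext ⟨i, j⟩
    simp only [Finset.mem_filter, mem_twoCycleSet, Finset.mem_singleton, Prod.mk.injEq]
    have := hM i
    have := hM j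
    have := lt_of_le_of_ne (hM b) hb
    grind
  have h3 : ((fixedSet w).filter fun i => ¬(i ≠ M ∧ i ≠ b)) = ∅ := by
    ext i
    simp only [Finset.mem_filter, mem_fixedSet, Finset.notMem_empty, iff_false]
    grind
  rw [involutionWeight, involutionWeight, card_bigNSet_restrict w w' h,
    card_twoCycleSet_restrict w w' h, card_fixedSet_restrict w w' h, h1, h2, h3]
  simp only [Finset.card_empty, Finset.card_singleton]
  ring

end Top

lemma sum_involutions_fixing_top {M : ι} (hM : ∀ i, i ≤ M) (q K : ℂ) :
    ∑ w : Equiv.Perm ι with w ^ 2 = 1 ∧ w M = M, involutionWeight q K w =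
      K * involutionSum q K {i // i ≠ M} := by
  rw [involutionSum, Finset.mul_sum]
  symm
  refine Finset.sum_bij (fun w _ => Equiv.Perm.ofSubtype w) ?_ ?_ ?_ ?_
  · intro w hw
    rw [Finset.mem_filter, ofSubtype_sq_eq_one_iff]
    exact ⟨Finset.mem_univ _, (Finset.mem_filter.1 hw).2,
      Equiv.Perm.ofSubtype_apply_of_not_mem _ (by simp)⟩
  · intro w _ w' _ h
    exact Equiv.Perm.ofSubtype_injective h
  · intro w hw
    simp only [Finset.mem_filter, Finset.mem_univ, true_and] at hw
    have key : Equiv.Perm.ofSubtype (w.subtypePerm (p := fun i => i ≠ M)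
        fun i => not_congr (by nth_rw 1 [← hw.2, w.injective.eq_iff])) = w :=
      Equiv.Perm.ofSubtype_subtypePerm _ fun i hi h => hi (h ▸ hw.2)
    refine ⟨_, ?_, key⟩
    rw [Finset.mem_filter, ← ofSubtype_sq_eq_one_iff, key]
    simp [hw.1]
  · intro w _
    refine (involutionWeight_of_fixes_top hM q K _ w (fun i => ?_) ?_).symm
    · rw [Equiv.Perm.ofSubtype_apply_coe]
    · exact Equiv.Perm.ofSubtype_apply_of_not_mem _ (by simp)

lemma sum_involutions_swapping_top {M : ι} (hM : ∀ i, i ≤ M) {b : ι} (hb : b ≠ M) (q K : ℂ) :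
    ∑ w : Equiv.Perm ι with w ^ 2 = 1 ∧ w M = b, involutionWeight q K w =
      q ^ (Finset.univ.filter fun i => b < i).card * (q - 1) *
        involutionSum q K {i // i ≠ M ∧ i ≠ b} := by
  rw [involutionSum, Finset.mul_sum]
  have hout (w : Equiv.Perm {i // i ≠ M ∧ i ≠ b}) {i : ι} (hi : i = M ∨ i = b) :
      Equiv.Perm.ofSubtype w i = i := Equiv.Perm.ofSubtype_apply_of_not_mem _ (by grind)
  have hin (w : Equiv.Perm {i // i ≠ M ∧ i ≠ b}) (i : {i // i ≠ M ∧ i ≠ b}) :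
      Equiv.swap M b (Equiv.Perm.ofSubtype w i) = w i := by
    rw [Equiv.Perm.ofSubtype_apply_coe, Equiv.swap_apply_of_ne_of_ne (w i).2.1 (w i).2.2]
  have hmul (w : Equiv.Perm {i // i ≠ M ∧ i ≠ b}) :
      (Equiv.swap M b * Equiv.Perm.ofSubtype w) ^ 2 = 1 ↔ w ^ 2 = 1 := by
    simp only [perm_sq_eq_one_iff, Equiv.Perm.mul_apply]
    constructor
    · intro h i
      have := h i
      rwa [hin, hin, Subtype.coe_inj] at this
    · intro h i
      by_cases hi : i ≠ M ∧ i ≠ b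
      · rw [hin w ⟨i, hi⟩, hin, h]
      · rcases (by grind : i = M ∨ i = b) with rfl | rfl
        · rw [hout w (.inl rfl), Equiv.swap_apply_left, hout w (.inr rfl), Equiv.swap_apply_right]
        · rw [hout w (.inr rfl), Equiv.swap_apply_right, hout w (.inl rfl), Equiv.swap_apply_left]
  symm
  refine Finset.sum_bij (fun w _ => Equiv.swap M b * Equiv.Perm.ofSubtype w) ?_ ?_ ?_ ?_
  · intro w hw
    have hw' : w ^ 2 = 1 := by simpa using hw
    rw [Finset.mem_filter, hmul, Equiv.Perm.mul_apply, hout w (.inl rfl), Equiv.swap_apply_left]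
    simp [hw']
  · intro w _ w' _ h
    exact Equiv.Perm.ofSubtype_injective (mul_left_cancel h)
  · intro w hw
    simp only [Finset.mem_filter, Finset.mem_univ, true_and] at hw
    have hsq := (perm_sq_eq_one_iff w).1 hw.1
    have hwb : w b = M := by rw [← hw.2, hsq]
    have key : Equiv.Perm.ofSubtype ((Equiv.swap M b * w).subtypePerm
        (p := fun i => i ≠ M ∧ i ≠ b) fun i => by
          simp only [Equiv.Perm.mul_apply]; grind) = Equiv.swap M b * w :=
      Equiv.Perm.ofSubtype_subtypePerm _ fun i hi => by
        simp only [Equiv.Perm.mul_apply] at hi; grind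
    refine ⟨_, ?_, (congrArg (Equiv.swap M b * ·) key).trans (by simp)⟩
    rw [Finset.mem_filter, ← hmul, key]
    simp [hw.1]
  · intro w _
    refine (involutionWeight_of_swaps_top hM q K _ hb w (fun i => hin w i) ?_ ?_).symm
    · rw [Equiv.Perm.mul_apply, hout w (.inl rfl), Equiv.swap_apply_left]
    · rw [Equiv.Perm.mul_apply, hout w (.inr rfl), Equiv.swap_apply_right]

lemma involutionSum_zero (q K : ℂ) : involutionSum q K (Fin 0) = 1 := by
  simp [involutionSum, Finset.filter_true_of_mem, Subsingleton.elim _ (1 : Equiv.Perm (Fin 0)),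
    involutionWeight, fixedSet, twoCycleSet, bigNSet]

lemma involutionSum_one (q K : ℂ) : involutionSum q K (Fin 1) = K := by
  have h := sum_involutions_fixing_top (M := (0 : Fin 1)) (by simp) q K
  rw [← involutionSum_congr q K (Fintype.orderIsoFinOfCardEq {i : Fin 1 // i ≠ 0} (k := 0)
    (by simp)), involutionSum_zero, mul_one] at h
  refine Eq.trans (Finset.sum_congr ?_ fun _ _ => rfl) h
  ext w
  simp [Subsingleton.elim (w _) (0 : Fin 1)]

/-- The recursion obtained by removing the cycle through the greatest element. -/
lemma involutionSum_succ_succ (q K : ℂ) (n : ℕ) :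
    involutionSum q K (Fin (n + 2)) = K * involutionSum q K (Fin (n + 1)) +
      q * (q ^ (n + 1) - 1) * involutionSum q K (Fin n) := by
  have h1 := sum_involutions_fixing_top (M := Fin.last (n + 1)) Fin.le_last q K
  rw [← involutionSum_congr q K (Fintype.orderIsoFinOfCardEq
    {i : Fin (n + 2) // i ≠ Fin.last (n + 1)} (k := n + 1) (by simp))] at h1
  have h2 (b : Fin (n + 1)) := sum_involutions_swapping_top (M := Fin.last (n + 1)) Fin.le_last
    (Fin.castSucc_lt_last b).ne q K
  have hcard (b : Fin (n + 1)) :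
      Fintype.card {i : Fin (n + 2) // i ≠ Fin.last (n + 1) ∧ i ≠ b.castSucc} = n := by
    rw [Fintype.card_subtype]
    have : (Finset.univ.filter fun i => i ≠ Fin.last (n + 1) ∧ i ≠ b.castSucc) =
        (Finset.univ.erase b.castSucc).erase (Fin.last (n + 1)) := by
      ext; simp
    rw [this, Finset.card_erase_of_mem (by simp [(Fin.castSucc_lt_last b).ne']),
      Finset.card_erase_of_mem (by simp)]
    simp
  have hIoi (b : Fin (n + 1)) : (Finset.univ.filter fun i => b.castSucc < i).card = n + 1 - b := by
    refine Eq.trans ?_ (Fin.card_Ioi b.castSucc)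
    congr 1
    ext; simp
  have h3 : involutionSum q K (Fin (n + 2)) = ∑ b : Fin (n + 2),
      ∑ w : Equiv.Perm (Fin (n + 2)) with w ^ 2 = 1 ∧ w (Fin.last (n + 1)) = b,
        involutionWeight q K w := by
    rw [involutionSum, ← Finset.sum_fiberwise _ fun w => w (Fin.last (n + 1))]
    simp only [Finset.filter_filter]
  rw [h3, Fin.sum_univ_castSucc, h1, add_comm]
  congr 1
  simp only [h2, hIoi, ← involutionSum_congr q K (Fintype.orderIsoFinOfCardEq _ (hcard _)),
    ← Finset.sum_mul]
  congr 1
  -- Reversing the order turns the exponents into `1, ..., n + 1`; the factor `q - 1` then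
  -- telescopes the geometric sum.
  rw [Fin.sum_univ_eq_sum_range fun b => q ^ (n + 1 - b), ← Finset.sum_range_reflect]
  have : ∀ j ∈ Finset.range (n + 1), q ^ (n + 1 - (n + 1 - 1 - j)) = q * q ^ j := by
    intro j hj
    rw [Finset.mem_range] at hj
    rw [← pow_succ']
    congr 1
    omega
  rw [Finset.sum_congr rfl this, ← Finset.mul_sum, mul_assoc, geom_sum_mul]

end Involutions

/-! ### Conjugation invariance and block triangular matrices -/

section MatrixSums

variable {F : Type*} [Field F]
  {ι κ : Type*} [Fintype ι] [DecidableEq ι] [Fintype κ] [DecidableEq κ]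

/-- The summand `χ(α tr x + tr x⁻¹)` of a matrix Kloosterman sum over an arbitrary index type. -/
def kloostermanTerm (χ : AddChar F ℂ) (α : F) (x : GL ι F) : ℂ :=
  χ (α * (x : Matrix ι ι F).trace + ((x⁻¹ : GL ι F) : Matrix ι ι F).trace)

/-- The sum of `χ(α tr x + tr x⁻¹)` over invertible matrices indexed by `ι`. -/
def scalarKloosterman [Fintype F] [DecidableEq F] (χ : AddChar F ℂ) (α : F)
    (ι : Type*) [Fintype ι] [DecidableEq ι] : ℂ :=
  ∑ x : GL ι F, kloostermanTerm χ α x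

/-- Reindexing of invertible matrices along an equivalence of index types. -/
def reindexGL (e : ι ≃ κ) : GL ι F ≃* GL κ F :=
  Units.mapEquiv (Matrix.reindexAlgEquiv F F e).toMulEquiv

lemma reindexGL_apply (e : ι ≃ κ) (x : GL ι F) (i j : κ) :
    (reindexGL e x : Matrix κ κ F) i j = (x : Matrix ι ι F) (e.symm i) (e.symm j) := rfl

lemma reindexGL_inv_apply (e : ι ≃ κ) (x : GL ι F) (i j : κ) :
    (((reindexGL e x)⁻¹ : GL κ F) : Matrix κ κ F) i j =
      ((x⁻¹ : GL ι F) : Matrix ι ι F) (e.symm i) (e.symm j) := rfl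

lemma kloostermanTerm_reindexGL (χ : AddChar F ℂ) (α : F) (e : ι ≃ κ) (x : GL ι F) :
    kloostermanTerm χ α (reindexGL e x) = kloostermanTerm χ α x := by
  unfold kloostermanTerm Matrix.trace
  simp only [Matrix.diag_apply, reindexGL_apply, reindexGL_inv_apply]
  rw [Equiv.sum_comp e.symm fun i => (x : Matrix ι ι F) i i,
    Equiv.sum_comp e.symm fun i => ((x⁻¹ : GL ι F) : Matrix ι ι F) i i]

lemma kloostermanTerm_conj (χ : AddChar F ℂ) (α : F) (g x : GL ι F) :
    kloostermanTerm χ α (g⁻¹ * x * g) = kloostermanTerm χ α x := by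
  have h (y : GL ι F) : ((g⁻¹ * y * g : GL ι F) : Matrix ι ι F).trace =
      (y : Matrix ι ι F).trace := by
    rw [Units.val_mul, Matrix.trace_mul_comm, ← Units.val_mul, mul_inv_cancel_left]
  have h' : (g⁻¹ * x * g)⁻¹ = g⁻¹ * x⁻¹ * g := by group
  rw [kloostermanTerm, kloostermanTerm, h', h, h]

/-- The invertible block upper triangular matrix with diagonal blocks `A`, `D`. -/
def blockUpper (A : GL ι F) (D : GL κ F) (B : Matrix ι κ F) : GL (ι ⊕ κ) F where
  val := Matrix.fromBlocks A B 0 D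
  inv := Matrix.fromBlocks (A⁻¹ : GL ι F)
    (-(((A⁻¹ : GL ι F) : Matrix ι ι F) * B * ((D⁻¹ : GL κ F) : Matrix κ κ F))) 0 (D⁻¹ : GL κ F)
  val_inv := by
    simp [Matrix.fromBlocks_multiply, ← Matrix.mul_assoc]
  inv_val := by
    simp [Matrix.fromBlocks_multiply, Matrix.mul_assoc]

lemma kloostermanTerm_blockUpper (χ : AddChar F ℂ) (α : F) (A : GL ι F) (D : GL κ F)
    (B : Matrix ι κ F) : kloostermanTerm χ α (blockUpper A D B) =
      kloostermanTerm χ α A * kloostermanTerm χ α D := by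
  have h1 : ((blockUpper A D B : GL (ι ⊕ κ) F) : Matrix (ι ⊕ κ) (ι ⊕ κ) F).trace =
      (A : Matrix ι ι F).trace + (D : Matrix κ κ F).trace := by
    simp [Matrix.trace, blockUpper]
  have h2 : (((blockUpper A D B)⁻¹ : GL (ι ⊕ κ) F) : Matrix (ι ⊕ κ) (ι ⊕ κ) F).trace =
      ((A⁻¹ : GL ι F) : Matrix ι ι F).trace + ((D⁻¹ : GL κ F) : Matrix κ κ F).trace := by
    change (Matrix.fromBlocks _ _ _ _).trace = _
    simp only [Matrix.trace, Matrix.diag_apply, Fintype.sum_sum_type, Matrix.fromBlocks_apply₁₁,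
      Matrix.fromBlocks_apply₂₂]
  rw [kloostermanTerm, kloostermanTerm, kloostermanTerm, h1, h2, ← AddChar.map_add_eq_mul]
  congr 1
  ring

lemma exists_blockUpper (x : GL (ι ⊕ κ) F)
    (hx : ∀ i j, (x : Matrix (ι ⊕ κ) (ι ⊕ κ) F) (.inr j) (.inl i) = 0) :
    ∃ A D B, blockUpper A D B = x := by
  obtain ⟨A, B, C, D, h⟩ : ∃ A B C D, (x : Matrix (ι ⊕ κ) (ι ⊕ κ) F) = Matrix.fromBlocks A B C D :=
    ⟨_, _, _, _, (Matrix.fromBlocks_toBlocks _).symm⟩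
  have hC : C = 0 := by
    ext j i
    simpa [h] using hx i j
  subst hC
  have hu : IsUnit (Matrix.fromBlocks A B 0 D) := h ▸ x.isUnit
  rw [Matrix.isUnit_fromBlocks_zero₂₁] at hu
  obtain ⟨⟨a, rfl⟩, ⟨d, rfl⟩⟩ := hu
  exact ⟨a, d, B, Units.ext h.symm⟩

lemma blockUpper_injective : Function.Injective
    fun t : GL ι F × GL κ F × Matrix ι κ F => blockUpper t.1 t.2.1 t.2.2 := by
  rintro ⟨A, D, B⟩ ⟨A', D', B'⟩ h
  have h' := congrArg Units.val h
  simp only [blockUpper, Matrix.fromBlocks_inj] at h'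
  obtain ⟨h1, h2, -, h3⟩ := h'
  rw [Units.ext h1, Units.ext h3, h2]

variable [Fintype F] [DecidableEq F]

lemma scalarKloosterman_congr (χ : AddChar F ℂ) (α : F) (e : ι ≃ κ) :
    scalarKloosterman χ α ι = scalarKloosterman χ α κ :=
  Fintype.sum_equiv (reindexGL e).toEquiv _ _ fun x => (kloostermanTerm_reindexGL χ α e x).symm

/-- Sums over block upper triangular matrices factor through the diagonal blocks. -/
lemma sum_blockUpper (χ : AddChar F ℂ) (α : F) (P : GL ι F → Prop) (Q : GL (ι ⊕ κ) F → Prop)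
    [DecidablePred P] [DecidablePred Q]
    (hQ : ∀ A D B, Q (blockUpper A D B) ↔ P A)
    (hQ' : ∀ x, Q x → ∀ i j, (x : Matrix (ι ⊕ κ) (ι ⊕ κ) F) (.inr j) (.inl i) = 0) :
    ∑ x with Q x, kloostermanTerm χ α x =
      (Fintype.card F : ℂ) ^ (Fintype.card ι * Fintype.card κ) *
        (∑ A with P A, kloostermanTerm χ α A) * scalarKloosterman χ α κ := by
  have h1 : ∑ x with Q x, kloostermanTerm χ α x =
      ∑ t ∈ (Finset.univ.filter P) ×ˢ (Finset.univ : Finset (GL κ F × Matrix ι κ F)),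
        kloostermanTerm χ α t.1 * kloostermanTerm χ α t.2.1 := by
    symm
    refine Finset.sum_bij (fun t _ => blockUpper t.1 t.2.1 t.2.2) ?_ ?_ ?_ ?_
    · intro t ht
      simpa [hQ] using ht
    · intro t _ t' _ h
      exact blockUpper_injective h
    · intro x hx
      have hx' : Q x := by simpa using hx
      obtain ⟨A, D, B, rfl⟩ := exists_blockUpper x (hQ' x hx')
      exact ⟨(A, D, B), by simpa [hQ] using hx', rfl⟩
    · intro t _
      exact (kloostermanTerm_blockUpper χ α _ _ _).symm
  rw [h1, Finset.sum_product, scalarKloosterman]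
  simp only [← Finset.univ_product_univ, Finset.sum_product, Finset.sum_const, Finset.card_univ,
    ← Finset.mul_sum, ← Finset.sum_mul, nsmul_eq_mul]
  have : (Fintype.card (Matrix ι κ F) : ℂ) =
      (Fintype.card F : ℂ) ^ (Fintype.card ι * Fintype.card κ) := by
    rw [← Nat.cast_pow]
    congr 1
    rw [Fintype.card_congr (Matrix.of (m := ι) (n := κ) (α := F)).symm]
    simp [← pow_mul, mul_comm]
  rw [this]
  ring

end MatrixSums

/-! ### Averaging over transvections and the matrix recursion -/

section ScalarRecursion

variable {F : Type*} [Field F] {ι κ : Type*} [Fintype ι] [DecidableEq ι] [Fintype κ] [DecidableEq κ]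

/-- Since `w` vanishes at `i₀`, the rank-one matrix `e wᵀ` squares to zero. -/
lemma shear_mul_shear (i₀ : ι) (w w' : ι → F) (hw : w i₀ = 0) (h : w + w' = 0) :
    (1 + Matrix.vecMulVec (Pi.single i₀ 1) w) * (1 + Matrix.vecMulVec (Pi.single i₀ 1) w') = 1 := by
  have : w' = -w := by rw [eq_neg_iff_add_eq_zero, add_comm, h]
  subst this
  simp [mul_add, add_mul, Matrix.vecMulVec_mul_vecMulVec, hw, Matrix.vecMulVec_neg]

/-- The matrix `1 + e vᵀ`, where `e` is the basis vector `i₀` and `v i₀` is replaced by zero. -/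
def shear (i₀ : ι) (v : ι → F) : GL ι F where
  val := 1 + Matrix.vecMulVec (Pi.single i₀ 1) (Function.update v i₀ 0)
  inv := 1 + Matrix.vecMulVec (Pi.single i₀ 1) (-Function.update v i₀ 0)
  val_inv := shear_mul_shear i₀ _ _ (by simp) (by simp)
  inv_val := shear_mul_shear i₀ _ _ (by simp) (by simp)

/-- The column `i₀` of `α x - x⁻¹` with the entry at `i₀` removed. -/
def columnDefect (α : F) (i₀ : ι) (x : GL ι F) : ι → F := fun j =>
  if j = i₀ then 0 else α * (x : Matrix ι ι F) j i₀ - ((x⁻¹ : GL ι F) : Matrix ι ι F) j i₀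

lemma columnDefect_eq_zero_iff (α : F) (i₀ : ι) (x : GL ι F) : columnDefect α i₀ x = 0 ↔
    ∀ j, j ≠ i₀ → ((x⁻¹ : GL ι F) : Matrix ι ι F) j i₀ = α * (x : Matrix ι ι F) j i₀ := by
  simp only [funext_iff, columnDefect, Pi.zero_apply, ite_eq_left_iff, sub_eq_zero]
  exact forall₂_congr fun _ _ => eq_comm

lemma kloostermanTerm_mul_shear (χ : AddChar F ℂ) (α : F) (i₀ : ι) (x : GL ι F) (v : ι → F) :
    kloostermanTerm χ α (x * shear i₀ v) =
      kloostermanTerm χ α x * χ (∑ j, columnDefect α i₀ x j * v j) := by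
  have h1 : ((x * shear i₀ v : GL ι F) : Matrix ι ι F).trace = (x : Matrix ι ι F).trace +
      ∑ j, (x : Matrix ι ι F) j i₀ * Function.update v i₀ 0 j := by
    simp [shear, mul_add, Matrix.mul_vecMulVec, Matrix.trace_vecMulVec, dotProduct]
  have h2 : (((x * shear i₀ v)⁻¹ : GL ι F) : Matrix ι ι F).trace =
      ((x⁻¹ : GL ι F) : Matrix ι ι F).trace -
        ∑ j, ((x⁻¹ : GL ι F) : Matrix ι ι F) j i₀ * Function.update v i₀ 0 j := by
    have : (((shear i₀ v)⁻¹ : GL ι F) : Matrix ι ι F) =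
      1 + Matrix.vecMulVec (Pi.single i₀ 1) (-Function.update v i₀ 0) := rfl
    rw [mul_inv_rev, Units.val_mul, this, Matrix.trace_mul_comm]
    simp [mul_add, Matrix.mul_vecMulVec, Matrix.trace_vecMulVec, dotProduct, sub_eq_add_neg,
      -Matrix.coe_units_inv]
  rw [kloostermanTerm, kloostermanTerm, h1, h2, ← AddChar.map_add_eq_mul]
  have h3 : ∑ j, columnDefect α i₀ x j * v j =
      α * ∑ j, (x : Matrix ι ι F) j i₀ * Function.update v i₀ 0 j -
        ∑ j, ((x⁻¹ : GL ι F) : Matrix ι ι F) j i₀ * Function.update v i₀ 0 j := by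
    rw [Finset.mul_sum, ← Finset.sum_sub_distrib]
    refine Finset.sum_congr rfl fun j _ => ?_
    by_cases hj : j = i₀
    · subst hj
      simp [columnDefect]
    · simp [columnDefect, hj]
      ring
  rw [h3]
  congr 1
  ring

lemma sum_addChar_dotProduct [Fintype F] {χ : AddChar F ℂ} (hχ : χ.IsPrimitive) (d : ι → F)
    [Decidable (d = 0)] :
    ∑ v : ι → F, χ (∑ j, d j * v j) = if d = 0 then (Fintype.card (ι → F) : ℂ) else 0 := by
  split_ifs with h
  · simp [h]
  · let ψ : AddChar (ι → F) ℂ := χ.compAddMonoidHom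
      { toFun := fun v => ∑ j, d j * v j
        map_zero' := by simp
        map_add' := fun v w => by simp [mul_add, Finset.sum_add_distrib] }
    refine AddChar.sum_eq_zero_of_ne_one (ψ := ψ) fun hψ => ?_
    obtain ⟨j, hj⟩ := Function.ne_iff.1 h
    refine hχ hj ?_
    ext c
    have := DFunLike.congr_fun hψ (Pi.single j c)
    simpa [ψ, Pi.single_apply] using this

/-- The matrices `x` with `x e = y` and `x⁻¹ e - α y` a multiple of `e`, for the basis vector `e`
at `i₀`. -/
def QuadraticOn (α : F) (i₀ : ι) (y : ι → F) (x : GL ι F) : Prop :=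
  (x : Matrix ι ι F).mulVec (Pi.single i₀ 1) = y ∧
    ∃ c : F, ((x⁻¹ : GL ι F) : Matrix ι ι F).mulVec (Pi.single i₀ 1) = α • y + c • Pi.single i₀ 1

lemma quadraticOn_iff (α : F) (i₀ : ι) (y : ι → F) (x : GL ι F) :
    QuadraticOn α i₀ y x ↔ (∀ j, (x : Matrix ι ι F) j i₀ = y j) ∧
      ∀ j, j ≠ i₀ → ((x⁻¹ : GL ι F) : Matrix ι ι F) j i₀ = α * y j := by
  rw [QuadraticOn]
  simp only [funext_iff, Matrix.mulVec_single_one, Matrix.col_apply]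
  refine and_congr_right fun _ => ⟨?_, fun h => ?_⟩
  · rintro ⟨c, hc⟩ j hj
    simpa [hj] using hc j
  · refine ⟨((x⁻¹ : GL ι F) : Matrix ι ι F) i₀ i₀ - α * y i₀, fun j => ?_⟩
    by_cases hj : j = i₀
    · subst hj
      simp
    · simp [h j hj, hj]

/-- The condition is expressed through `x`, `e` and `y` alone, so it is transported by any `g` in
the stabilizer of `e`. -/
lemma QuadraticOn.conj {α : F} {i₀ : ι} {y z : ι → F} {x : GL ι F} (h : QuadraticOn α i₀ y x)
    (g : GL ι F) (hg : (g : Matrix ι ι F).mulVec (Pi.single i₀ 1) = Pi.single i₀ 1)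
    (hz : (g : Matrix ι ι F).mulVec z = y) : QuadraticOn α i₀ z (g⁻¹ * x * g) := by
  have hinv {a b : ι → F} (hab : (g : Matrix ι ι F).mulVec a = b) :
      ((g⁻¹ : GL ι F) : Matrix ι ι F).mulVec b = a := by
    rw [← hab, Matrix.mulVec_mulVec, ← Units.val_mul]
    simp
  obtain ⟨h1, c, h2⟩ := h
  refine ⟨?_, c, ?_⟩
  · rw [Units.val_mul, Units.val_mul, ← Matrix.mulVec_mulVec, ← Matrix.mulVec_mulVec, hg, h1, hinv hz]
  · rw [show (g⁻¹ * x * g)⁻¹ = g⁻¹ * x⁻¹ * g by group, Units.val_mul, Units.val_mul,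
      ← Matrix.mulVec_mulVec, ← Matrix.mulVec_mulVec, hg, h2, Matrix.mulVec_add,
      Matrix.mulVec_smul, Matrix.mulVec_smul, hinv hz, hinv hg]

variable [Fintype F] [DecidableEq F]

lemma scalarKloosterman_eq_sum_columnDefect {χ : AddChar F ℂ} (hχ : χ.IsPrimitive) (α : F)
    (i₀ : ι) : scalarKloosterman χ α ι =
      ∑ x : GL ι F with columnDefect α i₀ x = 0, kloostermanTerm χ α x := by
  -- The average runs over all `v`, although `shear` ignores `v i₀`; this is harmless since the
  -- defect is zero at `i₀`.
  have h0 : (Fintype.card (ι → F) : ℂ) ≠ 0 := by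
    exact_mod_cast Fintype.card_ne_zero
  apply mul_left_cancel₀ h0
  calc (Fintype.card (ι → F) : ℂ) * scalarKloosterman χ α ι
      = ∑ v : ι → F, ∑ x : GL ι F, kloostermanTerm χ α (x * shear i₀ v) := by
        have (v : ι → F) : ∑ x : GL ι F, kloostermanTerm χ α (x * shear i₀ v) =
            scalarKloosterman χ α ι :=
          Fintype.sum_equiv (Equiv.mulRight (shear i₀ v)) _ _ fun _ => rfl
        simp [this]
    _ = ∑ x : GL ι F, kloostermanTerm χ α x * ∑ v : ι → F, χ (∑ j, columnDefect α i₀ x j * v j) := by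
        rw [Finset.sum_comm]
        simp only [kloostermanTerm_mul_shear, Finset.mul_sum]
    _ = _ := by
        simp only [sum_addChar_dotProduct hχ, mul_ite, mul_zero, ← Finset.sum_filter]
        rw [← Finset.sum_mul, mul_comm]

/-- The contribution of the matrices having the basis vector as an eigenvector. -/
lemma sum_columnDefect_eigenvector (χ : AddChar F ℂ) (α : F) :
    ∑ x : GL (Unit ⊕ κ) F with columnDefect α (.inl ()) x = 0 ∧
        ∀ j, j ≠ Sum.inl () → (x : Matrix (Unit ⊕ κ) (Unit ⊕ κ) F) j (.inl ()) = 0,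
      kloostermanTerm χ α x =
    (Fintype.card F : ℂ) ^ Fintype.card κ * scalarKloosterman χ α Unit *
      scalarKloosterman χ α κ := by
  have := sum_blockUpper χ α (ι := Unit) (κ := κ) (fun _ => True)
    (fun x => columnDefect α (.inl ()) x = 0 ∧
        ∀ j, j ≠ Sum.inl () → (x : Matrix (Unit ⊕ κ) (Unit ⊕ κ) F) j (.inl ()) = 0)
    (fun A D B => by
      have h : (((blockUpper A D B)⁻¹ : GL (Unit ⊕ κ) F) : Matrix (Unit ⊕ κ) (Unit ⊕ κ) F) =
        Matrix.fromBlocks _ _ 0 _ := rfl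
      rw [columnDefect_eq_zero_iff, h]
      simp [blockUpper])
    (fun x hx i j => hx.2 (.inr j) (by simp))
  simpa [scalarKloosterman] using this

open Classical in
-- Conjugate by the identity with column `k` replaced by `y`: its determinant is `y k`, it fixes `e`
-- because `k ≠ i₀`, and it sends the basis vector `k` to `y`.
lemma sum_quadraticOn_eq_single (χ : AddChar F ℂ) (α : F) {i₀ k : ι} (hk : k ≠ i₀) (y : ι → F)
    (hy : y k ≠ 0) : ∑ x with QuadraticOn α i₀ y x, kloostermanTerm χ α x =
      ∑ x with QuadraticOn α i₀ (Pi.single k 1) x, kloostermanTerm χ α x := by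
  have hdet : ((1 : Matrix ι ι F).updateCol k y).det ≠ 0 := by
    rwa [← Matrix.cramer_apply, Matrix.cramer_one]
  let g : GL ι F := Matrix.GeneralLinearGroup.mkOfDetNeZero _ hdet
  have hg : (g : Matrix ι ι F).mulVec (Pi.single i₀ 1) = Pi.single i₀ 1 := by
    ext j
    simp [g, Matrix.GeneralLinearGroup.mkOfDetNeZero, hk.symm,
      Matrix.one_apply, Pi.single_apply]
  have hgk : (g : Matrix ι ι F).mulVec (Pi.single k 1) = y := by
    ext j
    simp [g, Matrix.GeneralLinearGroup.mkOfDetNeZero]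
  refine Finset.sum_equiv (MulAut.conj g⁻¹).toEquiv (fun x => ?_) fun x _ => ?_
  · simp only [Finset.mem_filter, Finset.mem_univ, true_and]
    have hx : (MulAut.conj g⁻¹).toEquiv x = g⁻¹ * x * g := by simp
    rw [hx]
    refine ⟨fun h => h.conj g hg hgk, fun h => ?_⟩
    have := h.conj g⁻¹ (z := y) ?_ ?_
    · simpa [mul_assoc] using this
    · nth_rw 1 [← hg]
      rw [Matrix.mulVec_mulVec, ← Units.val_mul, inv_mul_cancel, Units.val_one, Matrix.one_mulVec]
    · rw [← hgk, Matrix.mulVec_mulVec, ← Units.val_mul, inv_mul_cancel, Units.val_one,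
        Matrix.one_mulVec]
  · have hx : (MulAut.conj g⁻¹).toEquiv x = g⁻¹ * x * g := by simp
    rw [hx, kloostermanTerm_conj]

/-- The companion-type matrices of determinant `-α⁻¹` with first column `(0, 1)`. -/
def companionGL {α : F} (hα : α ≠ 0) (d : F) : GL (Fin 2) F where
  val := !![0, α⁻¹; 1, d]
  inv := !![-(α * d), 1; α, 0]
  val_inv := by
    ext i j
    fin_cases i <;> fin_cases j <;> simp [hα, mul_comm d]
  inv_val := by
    ext i j
    fin_cases i <;> fin_cases j <;> simp [hα, mul_right_comm α d]

/-- The conditions leave only the entry `d` free, and `α tr A + tr A⁻¹ = αd - αd = 0`, so each of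
the `q` terms is `1`. -/
lemma sum_companion (χ : AddChar F ℂ) {α : F} (hα : α ≠ 0) :
    ∑ A : GL (Fin 2) F with ((A : GL (Fin 2) F) : Matrix (Fin 2) (Fin 2) F) 0 0 = 0 ∧
        (A : Matrix (Fin 2) (Fin 2) F) 1 0 = 1 ∧
        ((A⁻¹ : GL (Fin 2) F) : Matrix (Fin 2) (Fin 2) F) 1 0 = α, kloostermanTerm χ α A =
      Fintype.card F := by
  have hinv (d : F) : (((companionGL hα d)⁻¹ : GL (Fin 2) F) : Matrix (Fin 2) (Fin 2) F) =
    !![-(α * d), 1; α, 0] := rfl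
  have : (Fintype.card F : ℂ) = ∑ _d : F, 1 := by simp
  rw [this]
  symm
  refine Finset.sum_bij (fun d _ => companionGL hα d) ?_ ?_ ?_ ?_
  · intro d _
    rw [Finset.mem_filter, hinv]
    simp [companionGL]
  · intro d _ d' _ h
    have := congrArg (fun g : GL (Fin 2) F => (g : Matrix (Fin 2) (Fin 2) F) 1 1) h
    simpa [companionGL] using this
  · intro A hA
    simp only [Finset.mem_filter, Finset.mem_univ, true_and] at hA
    obtain ⟨h1, h2, h3⟩ := hA
    have hmul : ((A⁻¹ : GL (Fin 2) F) : Matrix (Fin 2) (Fin 2) F) * A = 1 := A.inv_mul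
    have h4 := congrFun (congrFun hmul 1) 0
    have h5 := congrFun (congrFun hmul 1) 1
    rw [Matrix.mul_apply, Fin.sum_univ_two] at h4 h5
    simp only [h1, h2, h3, mul_zero, mul_one, zero_add] at h4 h5
    have h6 : (A : Matrix (Fin 2) (Fin 2) F) 0 1 = α⁻¹ := by
      have h7 : ((A⁻¹ : GL (Fin 2) F) : Matrix (Fin 2) (Fin 2) F) 1 1 = 0 := h4
      rw [h7, zero_mul, add_zero] at h5
      exact eq_inv_of_mul_eq_one_right h5
    refine ⟨(A : Matrix (Fin 2) (Fin 2) F) 1 1, Finset.mem_univ _, Units.ext ?_⟩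
    ext i j
    fin_cases i <;> fin_cases j <;> simp [companionGL, h1, h2, h6]
  · intro d _
    rw [kloostermanTerm, hinv]
    simp [companionGL, Matrix.trace_fin_two]

open Classical in
lemma sum_quadraticOn_fin_two (χ : AddChar F ℂ) {α : F} (hα : α ≠ 0) :
    ∑ x : GL (Fin 2 ⊕ κ) F with QuadraticOn α (.inl 0) (Pi.single (.inl 1) 1) x,
        kloostermanTerm χ α x =
      (Fintype.card F : ℂ) ^ (2 * Fintype.card κ + 1) * scalarKloosterman χ α κ := by
  rw [sum_blockUpper χ α (fun A : GL (Fin 2) F => (A : Matrix (Fin 2) (Fin 2) F) 0 0 = 0 ∧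
        (A : Matrix (Fin 2) (Fin 2) F) 1 0 = 1 ∧
        ((A⁻¹ : GL (Fin 2) F) : Matrix (Fin 2) (Fin 2) F) 1 0 = α), sum_companion χ hα,
    Fintype.card_fin, pow_succ]
  · intro A D B
    have h : (((blockUpper A D B)⁻¹ : GL (Fin 2 ⊕ κ) F) : Matrix (Fin 2 ⊕ κ) (Fin 2 ⊕ κ) F) =
      Matrix.fromBlocks ((A⁻¹ : GL (Fin 2) F) : Matrix (Fin 2) (Fin 2) F) _ 0 _ := rfl
    rw [quadraticOn_iff, h]
    simp [blockUpper, Sum.forall, Fin.forall_fin_two, Pi.single_apply, and_assoc,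
      -Matrix.coe_units_inv]
  · intro x hx i j
    rw [quadraticOn_iff] at hx
    obtain ⟨h1, h2⟩ := hx
    fin_cases i
    · simpa using h1 (.inr j)
    -- In column `inl 0` of `x x⁻¹ = 1`, row `inr j` reduces to `x (inr j) (inl 1) * α = 0`. Here `α
    -- ≠ 0` makes the plane invariant.
    · have hmul : (x : Matrix (Fin 2 ⊕ κ) (Fin 2 ⊕ κ) F) *
        ((x⁻¹ : GL (Fin 2 ⊕ κ) F) : Matrix (Fin 2 ⊕ κ) (Fin 2 ⊕ κ) F) = 1 := x.mul_inv
      have h3 := congrFun (congrFun hmul (.inr j)) (.inl 0)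
      rw [Matrix.mul_apply, Fintype.sum_sum_type, Fin.sum_univ_two, h1,
        h2 (.inl 1) (by simp), Finset.sum_eq_zero fun i _ => by rw [h2 (.inr i) (by simp)]; simp]
        at h3
      simpa [hα] using h3

open Classical in
/-- The contribution of the matrices with a prescribed value `y` on the basis vector `i₀`, when `y`
is not a multiple of that vector. -/
lemma sum_quadraticOn (χ : AddChar F ℂ) {α : F} (hα : α ≠ 0) {i₀ k : ι} (hk : k ≠ i₀) (y : ι → F)
    (hy : y k ≠ 0) (n : ℕ) (hn : Fintype.card ι = n + 2) :
    ∑ x with QuadraticOn α i₀ y x, kloostermanTerm χ α x =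
      (Fintype.card F : ℂ) ^ (2 * n + 1) * scalarKloosterman χ α (Fin n) := by
  let e₀ : Fin 2 ⊕ {j // j ≠ i₀ ∧ j ≠ k} ≃ ι :=
    Equiv.ofBijective (Sum.elim ![i₀, k] Subtype.val) (by
      constructor
      · rintro (i | ⟨i, hi⟩) (j | ⟨j, hj⟩) h
        · fin_cases i <;> fin_cases j <;> simp_all
        · fin_cases i
          · exact absurd h.symm hj.1
          · exact absurd h.symm hj.2
        · fin_cases j
          · exact absurd h hi.1
          · exact absurd h hi.2
        · simp_all
      · intro j
        by_cases h0 : j = i₀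
        · exact ⟨.inl 0, h0.symm⟩
        by_cases h1 : j = k
        · exact ⟨.inl 1, h1.symm⟩
        exact ⟨.inr ⟨j, h0, h1⟩, rfl⟩)
  have hcard : Fintype.card {j // j ≠ i₀ ∧ j ≠ k} = n := by
    have := Fintype.card_congr e₀
    rw [Fintype.card_sum, Fintype.card_fin] at this
    omega
  rw [sum_quadraticOn_eq_single χ α hk y hy,
    ← scalarKloosterman_congr χ α (Fintype.equivFinOfCardEq hcard)]
  have hblock := sum_quadraticOn_fin_two (κ := {j // j ≠ i₀ ∧ j ≠ k}) χ hα
  rw [hcard] at hblock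
  rw [← hblock]
  symm
  refine Finset.sum_equiv (reindexGL e₀).toEquiv (fun x => ?_) fun x _ =>
    (kloostermanTerm_reindexGL χ α e₀ x).symm
  have h0 : i₀ = e₀ (.inl 0) := rfl
  have h1 : k = e₀ (.inl 1) := rfl
  simp only [Finset.mem_filter, Finset.mem_univ, true_and, quadraticOn_iff, h0, h1]
  rw [← e₀.forall_congr_right, ← e₀.forall_congr_right (q := fun j => j ≠ _ → _)]
  have hs (i j : Fin 2 ⊕ {j // j ≠ i₀ ∧ j ≠ k}) :
      (Pi.single (e₀ i) 1 : ι → F) (e₀ j) = (Pi.single i 1 : _ → F) j := by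
    simp [Pi.single_apply]
  simp only [MulEquiv.toEquiv_eq_coe, MulEquiv.coe_toEquiv, reindexGL_apply, reindexGL_inv_apply,
    Equiv.symm_apply_apply, hs, ne_eq, e₀.apply_eq_iff_eq]

lemma card_multiples (i₀ : ι) :
    (Finset.univ.filter fun y : ι → F => ∀ j, j ≠ i₀ → y j = 0).card = Fintype.card F := by
  symm
  refine Finset.card_bij (fun c _ => Pi.single i₀ c) ?_ ?_ ?_
  · intro c _
    simp +contextual
  · intro c _ d _ h
    simpa using h
  · intro y hy
    refine ⟨y i₀, Finset.mem_univ _, ?_⟩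
    ext j
    by_cases hj : j = i₀
    · subst hj; simp
    · simp only [Finset.mem_filter, Finset.mem_univ, true_and] at hy
      simp [hj, hy j hj]

lemma sum_columnDefect_noneigenvector (χ : AddChar F ℂ) {α : F} (hα : α ≠ 0) (i₀ : ι) (n : ℕ)
    (hn : Fintype.card ι = n + 2) :
    ∑ x : GL ι F with columnDefect α i₀ x = 0 ∧
        ¬∀ j, j ≠ i₀ → (x : Matrix ι ι F) j i₀ = 0, kloostermanTerm χ α x =
      ((Fintype.card F : ℂ) ^ (n + 2) - Fintype.card F) *
        ((Fintype.card F : ℂ) ^ (2 * n + 1) * scalarKloosterman χ α (Fin n)) := by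
  classical
  have hcard : ((Finset.univ.filter fun y : ι → F => ¬∀ j, j ≠ i₀ → y j = 0).card : ℂ) =
      (Fintype.card F : ℂ) ^ (n + 2) - Fintype.card F := by
    have := Finset.card_filter_add_card_filter_not (s := (Finset.univ : Finset (ι → F)))
      (fun y : ι → F => ∀ j, j ≠ i₀ → y j = 0)
    rw [card_multiples, Finset.card_univ, Fintype.card_fun, hn] at this
    rw [eq_sub_iff_add_eq']
    exact_mod_cast this
  -- Fibre the sum over the column `y = xe`; every `y` that is not a multiple of `e` contributes the
  -- same amount.
  rw [← hcard, ← nsmul_eq_mul, ← Finset.sum_const, Finset.sum_filter (p := fun y : ι → F => _),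
    ← Finset.sum_fiberwise _ fun x : GL ι F => fun j => (x : Matrix ι ι F) j i₀]
  refine Finset.sum_congr rfl fun y _ => ?_
  rw [Finset.filter_filter]
  by_cases hy : ¬∀ j, j ≠ i₀ → y j = 0
  · rw [if_pos hy]
    obtain ⟨k, hk, hyk⟩ : ∃ k, k ≠ i₀ ∧ y k ≠ 0 := by simpa using hy
    rw [← sum_quadraticOn χ hα hk y hyk n hn]
    refine Finset.sum_congr ?_ fun _ _ => rfl
    ext x
    simp only [Finset.mem_filter, Finset.mem_univ, true_and, quadraticOn_iff,
      columnDefect_eq_zero_iff]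
    constructor
    · rintro ⟨⟨h1, h2⟩, rfl⟩
      exact ⟨fun _ => rfl, h1⟩
    · rintro ⟨h1, h2⟩
      obtain rfl : (fun j => (x : Matrix ι ι F) j i₀) = y := funext h1
      exact ⟨⟨h2, hy⟩, rfl⟩
  · rw [if_neg hy]
    refine Finset.sum_eq_zero fun x hx => ?_
    simp only [Finset.mem_filter, Finset.mem_univ, true_and] at hx
    obtain ⟨⟨-, h⟩, rfl⟩ := hx
    exact absurd h hy

/-- The recursion for matrix Kloosterman sums at scalar matrices. -/
lemma scalarKloosterman_succ_succ {χ : AddChar F ℂ} (hχ : χ.IsPrimitive) {α : F} (hα : α ≠ 0)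
    (n : ℕ) : scalarKloosterman χ α (Fin (n + 2)) =
      (Fintype.card F : ℂ) ^ (n + 1) * scalarKloosterman χ α Unit *
          scalarKloosterman χ α (Fin (n + 1)) +
        ((Fintype.card F : ℂ) ^ (n + 2) - Fintype.card F) *
          ((Fintype.card F : ℂ) ^ (2 * n + 1) * scalarKloosterman χ α (Fin n)) := by
  have hn : Fintype.card (Unit ⊕ Fin (n + 1)) = n + 2 := by
    rw [Fintype.card_sum, Fintype.card_unit, Fintype.card_fin]
    omega
  rw [← scalarKloosterman_congr χ α (Fintype.equivFinOfCardEq hn),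
    scalarKloosterman_eq_sum_columnDefect hχ α (.inl ()),
    ← sum_columnDefect_noneigenvector χ hα (.inl ()) n hn]
  have h := sum_columnDefect_eigenvector (κ := Fin (n + 1)) χ α
  rw [Fintype.card_fin] at h
  rw [← h, ← Finset.filter_filter, ← Finset.filter_filter, Finset.sum_filter_add_sum_filter_not]

end ScalarRecursion

/-! ### The trace character and the comparison of recursions -/

section Main

variable (p : ℕ) [Fact p.Prime] {F : Type*} [Field F] [Fintype F] [Algebra (ZMod p) F]

/-- The additive character `phi` as a bundled character. -/
noncomputable def phiChar (F : Type*) [Field F] [Algebra (ZMod p) F] : AddChar F ℂ :=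
  (ZMod.stdAddChar (N := p)).compAddMonoidHom (Algebra.trace (ZMod p) F).toAddMonoidHom

/-- Nondegeneracy of the trace form supplies `b` with `Tr(ab) ≠ 0`, and the standard character of
`ZMod p` is injective. -/
lemma phiChar_isPrimitive : (phiChar p F).IsPrimitive := by
  intro a ha h
  have hp : ringChar F = p := by
    have := charP_of_injective_algebraMap (algebraMap (ZMod p) F).injective p
    exact ringChar.eq F p ▸ rfl
  subst hp
  obtain ⟨b, hb⟩ := FiniteField.trace_to_zmod_nondegenerate F ha
  refine hb (ZMod.injective_stdAddChar ?_)
  rw [AddChar.map_zero_eq_one]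
  exact DFunLike.congr_fun h b

variable [DecidableEq F]

lemma matrixKloosterman_smul_one (α : F) (n : ℕ) :
    matrixKloosterman p (α • (1 : Matrix (Fin n) (Fin n) F)) =
      scalarKloosterman (phiChar p F) α (Fin n) := by
  refine Finset.sum_congr rfl fun x _ => ?_
  rw [psi, smul_mul_assoc, one_mul, Matrix.trace_add, Matrix.trace_smul, smul_eq_mul]
  rfl

lemma kloosterman_eq_scalarKloosterman (α : F) :
    kloosterman p α = scalarKloosterman (phiChar p F) α Unit := by
  symm
  let e : Matrix Unit Unit F ≃* F :=
    { toFun := fun x => x () ()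
      invFun := fun c _ _ => c
      left_inv := fun x => rfl
      right_inv := fun c => rfl
      map_mul' := fun x y => by simp [Matrix.mul_apply] }
  refine Fintype.sum_equiv (Units.mapEquiv e).toEquiv _ _ fun x => ?_
  simp only [kloostermanTerm, Matrix.trace, Matrix.diag_apply, Finset.univ_unique,
    Finset.sum_singleton]
  rfl

lemma scalarKloosterman_zero (χ : AddChar F ℂ) (α : F) : scalarKloosterman χ α (Fin 0) = 1 := by
  simp [scalarKloosterman, kloostermanTerm, Matrix.trace]

/-- A matrix Kloosterman sum at a scalar matrix is a weighted sum over involutions. -/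
lemma scalarKloosterman_eq_involutionSum {χ : AddChar F ℂ} (hχ : χ.IsPrimitive) {α : F}
    (hα : α ≠ 0) (n : ℕ) : scalarKloosterman χ α (Fin n) =
      (Fintype.card F : ℂ) ^ (n * (n - 1) / 2) *
        involutionSum (Fintype.card F : ℂ) (scalarKloosterman χ α Unit) (Fin n) := by
  induction n using Nat.twoStepInduction with
  | zero => rw [scalarKloosterman_zero, involutionSum_zero]; simp
  | one =>
    rw [involutionSum_one, scalarKloosterman_congr χ α (Equiv.ofUnique (Fin 1) Unit)]
    simp
  | more n h0 h1 =>
    rw [scalarKloosterman_succ_succ hχ hα, involutionSum_succ_succ, h0, h1,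
      Nat.triangle_succ (n + 1), Nat.triangle_succ n]
    ring

lemma involutionSum_fin (q K : ℂ) (n : ℕ) : involutionSum q K (Fin n) =
    ∑ w ∈ (Finset.univ : Finset (Equiv.Perm (Fin n))).filter (fun w => w ^ 2 = 1),
      q ^ bigN w * (q - 1) ^ numTwoCycles w * K ^ numFixed w := rfl

end Main

end MatrixKloosterman

theorem mainTheorem7 (p : ℕ) [Fact p.Prime] (F : Type*) [Field F] [Fintype F] [DecidableEq F]
    [Algebra (ZMod p) F] (n : ℕ) (α : F) (hα : α ≠ 0) :
    MatrixKloosterman.matrixKloosterman p (α • (1 : Matrix (Fin n) (Fin n) F)) =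
      ∑ w ∈ (Finset.univ : Finset (Equiv.Perm (Fin n))).filter (fun w => w ^ 2 = 1),
        (Fintype.card F : ℂ) ^ (n * (n - 1) / 2 + MatrixKloosterman.bigN w) *
          ((Fintype.card F : ℂ) - 1) ^ MatrixKloosterman.numTwoCycles w *
          MatrixKloosterman.kloosterman p α ^ MatrixKloosterman.numFixed w := by
  rw [MatrixKloosterman.matrixKloosterman_smul_one,
    MatrixKloosterman.scalarKloosterman_eq_involutionSum
      (MatrixKloosterman.phiChar_isPrimitive p) hα,
    ← MatrixKloosterman.kloosterman_eq_scalarKloosterman, MatrixKloosterman.involutionSum_fin,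
    Finset.mul_sum]
  refine Finset.sum_congr rfl fun w _ => ?_
  rw [pow_add]
  ring
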